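/- Let $(X,d)$ be a metric space that is locally compact, incomplete and rectifiably connected (any two points are joined by a curve of finite length). Let $\partial X=\overline X\setminus X$, where $\overline X$ is the metric completion of $X$, let $d(x)=\operatorname{dist}(x,\partial X)$ for $x\in X$, and let $\ell$ denote the length of a curve with respect to $d$. The quasihyperbolic metric of $X$ is $$k(x,y)=\inf_\gamma\int_\gamma\frac{|dz|}{d(z)},$$ the infimum being over all rectifiable curves $\gamma$ in $X$ from $x$ to $y$, and a quasihyperbolic geodesic from $x$ to $y$ is a map $\alpha:[0,l]\to X$ with $\alpha(0)=x$, $\alpha(l)=y$ and $k(\alpha(s),\alpha(t))=|s-t|$ for all $s,t\in[0,l]$. For $c\ge 1$, the space $X$ is called $c$-uniform if any two points $x,y\in X$ are joined by a rectifiable curve $\gamma$ in $X$ with $\ell(\gamma)\le c\,d(x,y)$ and $\min\{\ell(\gamma[x,z]),\ell(\gamma[z,y])\}\le c\,d(z)$ for all $z\in\gamma$. For $a\ge 1$ and $x_0\in X$, the space $X$ is called quasihyperbolic $a$-John with center $x_0$ if, for every $x\in X$, every quasihyperbolic geodesic $\alpha$ from $x$ to $x_0$ is an $a$-cone arc, that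 is, an arc with $\ell(\alpha[x,z])\le a\,d(z)$ for all $z\in\alpha$. **Proposition.** For every $c\ge 1$ there is a constant $a\ge 1$, depending only on $c$, such that for every bounded $c$-uniform space $X$ as above the function $z\mapsto d(z)$ attains its maximum on $X$, and $X$ is quasihyperbolic $a$-John with center $x_0$ for every point $x_0\in X$ with $d(x_0)=\max_{z\in X}d(z)$. -/

import Mathlib

open scoped ENNReal

noncomputable section

namespace QH

variable {X : Type*} [MetricSpace X]

/-- The metric boundary `∂X`: the metric completion of `X` minus (the canonical copy of) `X`. -/
def metricBoundary (X : Type*) [MetricSpace X] : Set (UniformSpace.Completion X) :=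
  (Set.range ((↑) : X → UniformSpace.Completion X))ᶜ

/-- `d(x) = dist(x, ∂X)`, the distance being taken in the completion. It is meaningful when `∂X` is
nonempty, that is, when `X` is incomplete. -/
def bdryDist (x : X) : ℝ :=
  Metric.infDist (x : UniformSpace.Completion X) (metricBoundary X)

/-- The length of the part of the curve `γ` parametrized by `[s, t]`: the supremum, over all
partitions of `[s, t]`, of the sums of distances between consecutive points. -/
def curveLength (γ : ℝ → X) (s t : ℝ) : ℝ≥0∞ :=
  eVariationOn γ (Set.Icc s t)

/-- `γ : [s, t] → X` is a rectifiable curve from `x` to `y`; the values of `γ` outside `[s, t]`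
play no role. -/
structure IsRectifiableCurve (γ : ℝ → X) (s t : ℝ) (x y : X) : Prop where
  le : s ≤ t
  continuousOn : ContinuousOn γ (Set.Icc s t)
  source : γ s = x
  target : γ t = y
  length_ne_top : curveLength γ s t ≠ ⊤

/-- Any two points are joined by a rectifiable curve. -/
def RectifiablyConnected (X : Type*) [MetricSpace X] : Prop :=
  ∀ x y : X, ∃ (γ : ℝ → X) (s t : ℝ), IsRectifiableCurve γ s t x y

/-- The arc-length integral `∫_γ ρ |dz|` of a nonnegative function `ρ` along the rectifiable curve
`γ : [s, t] → X`, computed in the arc-length parametrization `[0, ℓ(γ)] → X` of `γ`. -/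
def arcLengthIntegral (ρ : X → ℝ≥0∞) (γ : ℝ → X) (s t : ℝ) : ℝ≥0∞ :=
  ∫⁻ r in Set.Icc 0 (curveLength γ s t).toReal,
    ρ (naturalParameterization γ (Set.Icc s t) s r)

/-- The quasihyperbolic metric: the infimum of `∫_γ |dz| / d(z)` over all rectifiable curves `γ`
from `x` to `y`. It takes extended values here; it is finite on a rectifiably connected, locally
compact, incomplete space. -/
def qhDist (x y : X) : ℝ≥0∞ :=
  ⨅ (γ : ℝ → X) (s : ℝ) (t : ℝ) (_ : IsRectifiableCurve γ s t x y),
    arcLengthIntegral (fun z => (ENNReal.ofReal (bdryDist z))⁻¹) γ s t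

/-- `α : [0, l] → X` is a quasihyperbolic geodesic from `x` to `y`, that is, a geodesic of the
space `(X, k)`, where `k` is the quasihyperbolic metric. -/
structure IsQHGeodesic (α : ℝ → X) (l : ℝ) (x y : X) : Prop where
  nonneg : 0 ≤ l
  source : α 0 = x
  target : α l = y
  isometry : ∀ s ∈ Set.Icc 0 l, ∀ t ∈ Set.Icc 0 l,
    qhDist (α s) (α t) = ENNReal.ofReal |s - t|

/-- `α : [s, t] → X` is an `a`-cone arc from `x` to `y`: an arc (a continuous injective map of a
compact interval, hence an embedding) such that `ℓ(α[x, z]) ≤ a d(z)` for every point `z` of `α`. -/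
structure IsConeArc (a : ℝ) (α : ℝ → X) (s t : ℝ) (x y : X) : Prop where
  le : s ≤ t
  continuousOn : ContinuousOn α (Set.Icc s t)
  injOn : Set.InjOn α (Set.Icc s t)
  source : α s = x
  target : α t = y
  cone : ∀ r ∈ Set.Icc s t, curveLength α s r ≤ ENNReal.ofReal (a * bdryDist (α r))

/-- `X` is quasihyperbolic `a`-John with center `x₀`: every quasihyperbolic geodesic from a point
`x` to `x₀` is an `a`-cone arc. -/
def IsQHJohnWithCenter (a : ℝ) (x₀ : X) : Prop :=
  ∀ (x : X) (α : ℝ → X) (l : ℝ), IsQHGeodesic α l x x₀ → IsConeArc a α 0 l x x₀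

/-- `γ : [s, t] → X` is a `c`-uniform curve from `x` to `y`. -/
structure IsUniformCurve (c : ℝ) (γ : ℝ → X) (s t : ℝ) (x y : X) : Prop
    extends IsRectifiableCurve γ s t x y where
  quasiconvex : curveLength γ s t ≤ ENNReal.ofReal (c * dist x y)
  double_cone : ∀ r ∈ Set.Icc s t,
    min (curveLength γ s r) (curveLength γ r t) ≤ ENNReal.ofReal (c * bdryDist (γ r))

/-- `X` is `c`-uniform: any two points are joined by a `c`-uniform curve. -/
def IsUniform (c : ℝ) (X : Type*) [MetricSpace X] : Prop :=
  ∀ x y : X, ∃ (γ : ℝ → X) (s t : ℝ), IsUniformCurve c γ s t x y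

end QH

end

/-!
The estimates rest on two bounds. The lower bound `log (1 + d(x,y) / d(x)) ≤ k(x,y)` holds in
every incomplete locally compact space; in a `c`-uniform space there is also the upper bound
`k(x,y) ≤ 2 (1 + 2c) log (1 + c d(x,y) / m)` for `m ≤ min (d(x), d(y))`, obtained by integrating
along a uniform curve (`QH.log_le_qhDist`, `QH.IsUniform.qhDist_le`).

The cone condition is a one-sided form of the argument of Gehring and Osgood. The center `x₀` is a
maximum point of `d`, so along a quasihyperbolic geodesic `α` from `x` to `x₀` the function `d`
keeps growing, up to constants. On a subarc where `d` lies between `m` at the endpoints and `2m`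
everywhere, the metric distance of the endpoints is at most `4m` times the quasihyperbolic length
`T`; with the upper bound above, `T ≤ 2 (1 + 2c) log (1 + 4cT)`, which bounds `T` by `720 c³`
(`QH.IsQHGeodesic.sub_le_of_le_two_mul`). Any subarc on which `d` stays below twice its initial
value can be prolonged towards `x₀` to one of this kind
(`QH.IsQHGeodesic.sub_le_of_forall_le_two_mul`). Hence `d` never drops by more than a bounded factor
(`QH.IsQHGeodesic.bdryDist_le_of_le`), and its running maximum doubles within a fixed
quasihyperbolic time, so that the length of an initial arc is dominated by a geometric series whose
sum is comparable to that maximum (`QH.IsQHGeodesic.curveLength_zero_le`).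

That `d` attains its maximum is a Hopf–Rinow argument: the points reached from a point `p` by
`1`-Lipschitz curves of bounded length that stay at distance at least `δ` from the boundary form a
relatively compact set (`QH.isCompact_closure_reachableSet`), and in a bounded uniform space this
set contains `{z | d(p) ≤ d(z)}` when `δ = d(p) / (2c)`.
-/

namespace QH

open Set Filter Topology MeasureTheory

/-! ### Curves and their arc-length parametrization -/

section Curves

variable {X : Type*} [MetricSpace X]

theorem curveLength_add (γ : ℝ → X) {s q t : ℝ} (hsq : s ≤ q) (hqt : q ≤ t) :
    curveLength γ s q + curveLength γ q t = curveLength γ s t := by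
  simpa [curveLength] using eVariationOn.Icc_add_Icc γ (s := univ) hsq hqt (mem_univ q)

theorem edist_le_curveLength (γ : ℝ → X) {s t : ℝ} (h : s ≤ t) :
    edist (γ s) (γ t) ≤ curveLength γ s t :=
  eVariationOn.edist_le γ (left_mem_Icc.2 h) (right_mem_Icc.2 h)

/-- The arc-length function of a continuous curve of finite length is continuous. -/
theorem continuousOn_variationOnFromTo {γ : ℝ → X} {s t : ℝ} (hst : s ≤ t)
    (hγ : ContinuousOn γ (Icc s t)) (hL : curveLength γ s t ≠ ⊤) :
    ContinuousOn (variationOnFromTo γ (Icc s t) s) (Icc s t) := by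
  have hbv : BoundedVariationOn γ (Icc s t) := hL
  have hloc := hbv.locallyBoundedVariationOn
  intro q hq
  have h1 := hbv.tendsto_eVariationOn_Icc_zero_left ((hγ q hq).mono inter_subset_left)
  have h2 := hbv.tendsto_eVariationOn_Icc_zero_right q ((hγ q hq).mono inter_subset_left)
  have h3 := h1.add h2
  rw [add_zero] at h3
  rw [ContinuousWithinAt, tendsto_iff_edist_tendsto_0]
  refine tendsto_of_tendsto_of_tendsto_of_le_of_le' tendsto_const_nhds h3
    (Eventually.of_forall fun _ => zero_le) ?_
  filter_upwards [self_mem_nhdsWithin] with p hp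
  have key : ∀ a ∈ Icc s t, ∀ b ∈ Icc s t, a ≤ b →
      edist (variationOnFromTo γ (Icc s t) s a) (variationOnFromTo γ (Icc s t) s b)
        ≤ eVariationOn γ (Icc s t ∩ Icc a b) := by
    intro a ha b hb hab
    have := variationOnFromTo.add hloc (left_mem_Icc.2 hst) ha hb
    rw [edist_comm, edist_dist, Real.dist_eq, ← this, add_sub_cancel_left,
      variationOnFromTo.eq_of_le _ _ hab, abs_of_nonneg ENNReal.toReal_nonneg,
      ENNReal.ofReal_toReal (hloc a b ha hb)]
  rcases le_total p q with h | h
  · exact (key p hp q hq h).trans le_self_add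
  · rw [edist_comm]
    exact (key q hq p hp h).trans le_add_self

/-- The arc-length parametrization at `r` is a point of the curve that cuts it into parts of
lengths `r` and `L - r`. -/
theorem IsRectifiableCurve.exists_naturalParameterization_eq {γ : ℝ → X} {s t : ℝ} {x y : X}
    (h : IsRectifiableCurve γ s t x y) {r : ℝ} (hr : r ∈ Icc 0 (curveLength γ s t).toReal) :
    ∃ q ∈ Icc s t, naturalParameterization γ (Icc s t) s r = γ q ∧
      curveLength γ s q = ENNReal.ofReal r ∧
      curveLength γ q t = ENNReal.ofReal ((curveLength γ s t).toReal - r) := by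
  have hbv : BoundedVariationOn γ (Icc s t) := h.length_ne_top
  have hloc := hbv.locallyBoundedVariationOn
  have hs := left_mem_Icc.2 h.le
  have hV : ∀ q ∈ Icc s t,
      variationOnFromTo γ (Icc s t) s q = (curveLength γ s q).toReal := by
    intro q hq
    rw [variationOnFromTo.eq_of_le _ _ hq.1, curveLength,
      inter_eq_right.2 (Icc_subset_Icc le_rfl hq.2)]
  have hsurj := intermediate_value_Icc h.le
    (continuousOn_variationOnFromTo h.le h.continuousOn h.length_ne_top)
  rw [variationOnFromTo.self, hV t (right_mem_Icc.2 h.le)] at hsurj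
  obtain ⟨q, hq, hqr⟩ := hsurj hr
  have hadd := curveLength_add γ hq.1 hq.2
  have hfin : curveLength γ s q ≠ ⊤ := ne_top_of_le_ne_top h.length_ne_top
    (hadd ▸ le_self_add)
  have hfin' : curveLength γ q t ≠ ⊤ := ne_top_of_le_ne_top h.length_ne_top
    (hadd ▸ le_add_self)
  have hq' : (curveLength γ s q).toReal = r := (hV q hq).symm.trans hqr
  refine ⟨q, hq, ?_, ?_, ?_⟩
  · have := edist_naturalParameterization_eq_zero hloc hs hq
    rw [hqr] at this
    exact edist_eq_zero.1 this
  · rw [← hq', ENNReal.ofReal_toReal hfin]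
  · rw [← hadd, ENNReal.toReal_add hfin hfin', hq', add_sub_cancel_left,
      ENNReal.ofReal_toReal hfin']

theorem IsRectifiableCurve.lipschitzOnWith_naturalParameterization {γ : ℝ → X} {s t : ℝ} {x y : X}
    (h : IsRectifiableCurve γ s t x y) :
    LipschitzOnWith 1 (naturalParameterization γ (Icc s t) s)
      (Icc 0 (curveLength γ s t).toReal) := by
  have key : ∀ a ∈ Icc 0 (curveLength γ s t).toReal, ∀ b ∈ Icc 0 (curveLength γ s t).toReal,
      a ≤ b → edist (naturalParameterization γ (Icc s t) s a)
        (naturalParameterization γ (Icc s t) s b) ≤ edist a b := by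
    intro a ha b hb hab
    obtain ⟨p, hp, hpa, hp1, -⟩ := h.exists_naturalParameterization_eq ha
    obtain ⟨q, hq, hqb, hq1, -⟩ := h.exists_naturalParameterization_eq hb
    rw [hpa, hqb]
    rcases le_total p q with hpq | hqp
    · have h1 := curveLength_add γ hp.1 hpq
      have h2 : curveLength γ p q = ENNReal.ofReal (b - a) := by
        rw [hp1, hq1] at h1
        rw [ENNReal.ofReal_sub _ ha.1, ← h1, ENNReal.add_sub_cancel_left ENNReal.ofReal_ne_top]
      refine (edist_le_curveLength γ hpq).trans ?_
      rw [h2, edist_comm, edist_dist, Real.dist_eq, abs_of_nonneg (sub_nonneg.2 hab)]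
    · have h1 := curveLength_add γ hq.1 hqp
      rw [hp1, hq1] at h1
      have h3 : ENNReal.ofReal b + curveLength γ q p ≤ ENNReal.ofReal b + 0 := by
        rw [h1, add_zero]; exact ENNReal.ofReal_le_ofReal hab
      have h2 : curveLength γ q p = 0 :=
        nonpos_iff_eq_zero.1 ((ENNReal.add_le_add_iff_left ENNReal.ofReal_ne_top).1 h3)
      refine le_trans ?_ zero_le
      rw [edist_comm, ← h2]
      exact edist_le_curveLength γ hqp
  intro a ha b hb
  rw [ENNReal.coe_one, one_mul]
  rcases le_total a b with hab | hab
  · exact key a ha b hb hab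
  · rw [edist_comm, edist_comm a]
    exact key b hb a ha hab

theorem IsRectifiableCurve.naturalParameterization_zero {γ : ℝ → X} {s t : ℝ} {x y : X}
    (h : IsRectifiableCurve γ s t x y) : naturalParameterization γ (Icc s t) s 0 = x := by
  obtain ⟨q, hq, h1, h2, -⟩ := h.exists_naturalParameterization_eq
    (left_mem_Icc.2 ENNReal.toReal_nonneg)
  have := edist_le_curveLength γ hq.1
  rw [h2, ENNReal.ofReal_zero, nonpos_iff_eq_zero, edist_eq_zero] at this
  rw [h1, ← this, h.source]

theorem IsRectifiableCurve.naturalParameterization_length {γ : ℝ → X} {s t : ℝ} {x y : X}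
    (h : IsRectifiableCurve γ s t x y) :
    naturalParameterization γ (Icc s t) s (curveLength γ s t).toReal = y := by
  obtain ⟨q, hq, h1, -, h2⟩ := h.exists_naturalParameterization_eq
    (right_mem_Icc.2 ENNReal.toReal_nonneg)
  have := edist_le_curveLength γ hq.2
  rw [h2, sub_self, ENNReal.ofReal_zero, nonpos_iff_eq_zero, edist_eq_zero] at this
  rw [h1, this, h.target]

theorem IsRectifiableCurve.dist_le_length {γ : ℝ → X} {s t : ℝ} {x y : X}
    (h : IsRectifiableCurve γ s t x y) : dist x y ≤ (curveLength γ s t).toReal := by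
  rw [← h.source, ← h.target, dist_edist]
  exact ENNReal.toReal_mono h.length_ne_top (edist_le_curveLength γ h.le)

end Curves

/-! ### The distance to the boundary -/

section BoundaryDistance

variable {X : Type*} [MetricSpace X]

theorem bdryDist_le_add_dist (x y : X) : bdryDist x ≤ bdryDist y + dist x y := by
  have := Metric.infDist_le_infDist_add_dist (s := metricBoundary X)
    (x := (x : UniformSpace.Completion X)) (y := y)
  rwa [UniformSpace.Completion.dist_eq] at this

theorem bdryDist_nonneg (x : X) : 0 ≤ bdryDist x :=
  Metric.infDist_nonneg

theorem continuous_bdryDist : Continuous (bdryDist : X → ℝ) :=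
  (Metric.continuous_infDist_pt _).comp (UniformSpace.Completion.continuous_coe X)

theorem metricBoundary_nonempty (h : ¬ CompleteSpace X) : (metricBoundary X).Nonempty := by
  by_contra hne
  rw [not_nonempty_iff_eq_empty, metricBoundary, compl_empty_iff] at hne
  exact h ((UniformSpace.Completion.isUniformInducing_coe X).completeSpace
    (hne ▸ completeSpace_iff_isComplete_univ.1 inferInstance))

/-- A locally compact space is open in its completion, so a point of an incomplete one has positive
distance to the boundary. -/
theorem bdryDist_pos [LocallyCompactSpace X] (h : ¬ CompleteSpace X) (x : X) : 0 < bdryDist x := by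
  obtain ⟨ε, hε, hK⟩ := Metric.exists_isCompact_closedBall x
  refine hε.trans_le ((Metric.le_infDist (metricBoundary_nonempty h)).2 fun w hw => ?_)
  by_contra! hlt
  refine hw ?_
  have hcl : w ∈ closure (Metric.ball (x : UniformSpace.Completion X) ε ∩ range ((↑) : X → _)) :=
    UniformSpace.Completion.denseRange_coe.open_subset_closure_inter Metric.isOpen_ball
      (by rwa [Metric.mem_ball'])
  have hsub : Metric.ball (x : UniformSpace.Completion X) ε ∩ range ((↑) : X → _) ⊆
      (↑) '' Metric.closedBall x ε := by
    rintro _ ⟨hz, z, rfl⟩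
    rw [Metric.mem_ball, UniformSpace.Completion.dist_eq] at hz
    exact ⟨z, hz.le, rfl⟩
  have := closure_minimal hsub (hK.image (UniformSpace.Completion.continuous_coe X)).isClosed hcl
  exact image_subset_range _ _ this

/-- A Cauchy sequence that stays away from the boundary converges in the space. -/
theorem isComplete_setOf_le_bdryDist {δ : ℝ} (hδ : 0 < δ) :
    IsComplete {z : X | δ ≤ bdryDist z} := by
  have hind := UniformSpace.Completion.isUniformInducing_coe X
  rw [← isComplete_image_iff hind]
  have : ((↑) : X → UniformSpace.Completion X) '' {z : X | δ ≤ bdryDist z} =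
      {w | δ ≤ Metric.infDist w (metricBoundary X)} := by
    refine Subset.antisymm (by rintro _ ⟨z, hz, rfl⟩; exact hz) fun w hw => ?_
    by_cases hwX : w ∈ range ((↑) : X → UniformSpace.Completion X)
    · obtain ⟨z, rfl⟩ := hwX
      exact ⟨z, hw, rfl⟩
    · have h0 : Metric.infDist w (metricBoundary X) = 0 := Metric.infDist_zero_of_mem hwX
      rw [mem_ofPred_eq, h0] at hw
      exact absurd hw hδ.not_ge
  rw [this]
  exact (isClosed_le continuous_const (Metric.continuous_infDist_pt _)).isComplete

end BoundaryDistance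

/-! ### Bounds for the quasihyperbolic distance -/

section Bounds

theorem lintegral_inv_add {m L : ℝ} (hm : 0 < m) (hL : 0 ≤ L) :
    ∫⁻ r in Icc 0 L, (ENNReal.ofReal (m + r))⁻¹ = ENNReal.ofReal (Real.log (1 + L / m)) := by
  have hcont : ContinuousOn (fun r : ℝ => (m + r)⁻¹) (Icc 0 L) :=
    (continuousOn_const.add continuousOn_id).inv₀ fun r hr => (add_pos_of_pos_of_nonneg hm hr.1).ne'
  have hint : ∫ r in Icc 0 L, (m + r)⁻¹ = Real.log (1 + L / m) := by
    rw [integral_Icc_eq_integral_Ioc, ← intervalIntegral.integral_of_le hL,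
      intervalIntegral.integral_comp_add_left (fun r => r⁻¹), add_zero,
      integral_inv_of_pos hm (by positivity), add_div, div_self hm.ne']
  rw [← hint, ofReal_integral_eq_lintegral_ofReal (hcont.integrableOn_compact isCompact_Icc)]
  · refine setLIntegral_congr_fun measurableSet_Icc fun r hr => ?_
    exact (ENNReal.ofReal_inv_of_pos (add_pos_of_pos_of_nonneg hm hr.1)).symm
  · refine (ae_restrict_iff' measurableSet_Icc).2 (Eventually.of_forall fun r hr => ?_)
    exact inv_nonneg.2 (add_pos_of_pos_of_nonneg hm hr.1).le

theorem lintegral_inv_add_sub {m L : ℝ} (hm : 0 < m) (hL : 0 ≤ L) :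
    ∫⁻ r in Icc 0 L, (ENNReal.ofReal (m + (L - r)))⁻¹ =
      ENNReal.ofReal (Real.log (1 + L / m)) := by
  rw [← lintegral_inv_add hm hL, ← lintegral_indicator measurableSet_Icc,
    ← lintegral_indicator measurableSet_Icc,
    ← lintegral_sub_left_eq_self ((Icc 0 L).indicator fun r => (ENNReal.ofReal (m + r))⁻¹) L]
  refine lintegral_congr fun r => ?_
  have : L - r ∈ Icc 0 L ↔ r ∈ Icc 0 L := by
    simp only [mem_Icc]; constructor <;> rintro ⟨h1, h2⟩ <;> constructor <;> linarith
  by_cases hr : r ∈ Icc 0 L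
  · rw [indicator_of_mem hr, indicator_of_mem (this.2 hr)]
  · rw [indicator_of_notMem hr, indicator_of_notMem (mt this.1 hr)]

variable {X : Type*} [MetricSpace X]

/-- The standard lower bound for the quasihyperbolic distance: at arc length `r` from `x`, a curve
has distance at most `d(x) + r` to the boundary. -/
theorem log_le_qhDist {x y : X} (hx : 0 < bdryDist x) :
    ENNReal.ofReal (Real.log (1 + dist x y / bdryDist x)) ≤ qhDist x y := by
  refine le_iInf fun γ => le_iInf fun s => le_iInf fun t => le_iInf fun h => ?_
  have hL : 0 ≤ (curveLength γ s t).toReal := ENNReal.toReal_nonneg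
  calc ENNReal.ofReal (Real.log (1 + dist x y / bdryDist x))
      ≤ ENNReal.ofReal (Real.log (1 + (curveLength γ s t).toReal / bdryDist x)) := by
        gcongr
        exact h.dist_le_length
    _ = ∫⁻ r in Icc 0 (curveLength γ s t).toReal, (ENNReal.ofReal (bdryDist x + r))⁻¹ :=
        (lintegral_inv_add hx hL).symm
    _ ≤ _ := by
        refine setLIntegral_mono' measurableSet_Icc fun r hr => ?_
        refine ENNReal.inv_le_inv.2 (ENNReal.ofReal_le_ofReal ?_)
        have h1 := h.lipschitzOnWith_naturalParameterization.dist_le_mul _ hr 0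
          (left_mem_Icc.2 hL)
        rw [h.naturalParameterization_zero, NNReal.coe_one, one_mul, Real.dist_eq, sub_zero,
          abs_of_nonneg hr.1] at h1
        exact (bdryDist_le_add_dist _ x).trans (by gcongr)

/-- The double cone condition and the Lipschitz bounds for `d` along a uniform curve, in terms of
its arc-length parametrization. -/
theorem IsUniformCurve.bdryDist_ge {c : ℝ} {γ : ℝ → X} {s t : ℝ} {x y : X}
    (hc : 0 ≤ c) (h : IsUniformCurve c γ s t x y) {r : ℝ}
    (hr : r ∈ Icc 0 (curveLength γ s t).toReal) :
    min r ((curveLength γ s t).toReal - r) ≤ c * bdryDist (naturalParameterization γ (Icc s t) s r)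
      ∧ bdryDist x - r ≤ bdryDist (naturalParameterization γ (Icc s t) s r)
      ∧ bdryDist y - ((curveLength γ s t).toReal - r) ≤
        bdryDist (naturalParameterization γ (Icc s t) s r) := by
  obtain ⟨q, hq, hqr, h1, h2⟩ := h.exists_naturalParameterization_eq hr
  have hL : 0 ≤ (curveLength γ s t).toReal := ENNReal.toReal_nonneg
  have hlip := h.lipschitzOnWith_naturalParameterization
  refine ⟨?_, ?_, ?_⟩
  · have h3 := h.double_cone q hq
    rw [h1, h2, ← ENNReal.ofReal_min, ENNReal.ofReal_le_ofReal_iff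
      (mul_nonneg hc (bdryDist_nonneg _))] at h3
    rwa [hqr]
  · have h1 := hlip.dist_le_mul _ (left_mem_Icc.2 hL) _ hr
    rw [h.naturalParameterization_zero, NNReal.coe_one, one_mul, Real.dist_eq, zero_sub, abs_neg,
      abs_of_nonneg hr.1] at h1
    linarith [bdryDist_le_add_dist x (naturalParameterization γ (Icc s t) s r)]
  · have h1 := hlip.dist_le_mul _ (right_mem_Icc.2 hL) _ hr
    rw [h.naturalParameterization_length, NNReal.coe_one, one_mul, Real.dist_eq,
      abs_of_nonneg (sub_nonneg.2 hr.2)] at h1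
    linarith [bdryDist_le_add_dist y (naturalParameterization γ (Icc s t) s r)]

/-- In a `c`-uniform space the quasihyperbolic distance is at most logarithmic in the relative
distance. -/
theorem IsUniform.qhDist_le {c : ℝ} (hc : 1 ≤ c) (hX : IsUniform c X) {m : ℝ} (hm : 0 < m)
    {x y : X} (hx : m ≤ bdryDist x) (hy : m ≤ bdryDist y) :
    qhDist x y ≤ ENNReal.ofReal (2 * (1 + 2 * c) * Real.log (1 + c * dist x y / m)) := by
  obtain ⟨γ, s, t, h⟩ := hX x y
  set L := (curveLength γ s t).toReal with hLdef
  have hL : 0 ≤ L := ENNReal.toReal_nonneg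
  have hLc : L ≤ c * dist x y := ENNReal.toReal_le_of_le_ofReal (by positivity) h.quasiconvex
  have hC : 0 < 1 + 2 * c := by linarith
  -- At arc length `r` from an endpoint that is not the farther one, `d ≥ r / c` and `d ≥ m - r`;
  -- a convex combination of these bounds is `d ≥ (m + r) / (1 + 2 * c)`.
  have hpt : ∀ r ∈ Icc 0 L, (ENNReal.ofReal (bdryDist (naturalParameterization γ (Icc s t) s r)))⁻¹
      ≤ ENNReal.ofReal (1 + 2 * c) * ((ENNReal.ofReal (m + r))⁻¹ +
        (ENNReal.ofReal (m + (L - r)))⁻¹) := by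
    intro r hr
    obtain ⟨h1, h2, h3⟩ := h.bdryDist_ge (by linarith) hr
    set D := bdryDist (naturalParameterization γ (Icc s t) s r)
    have hinv : ∀ u, 0 < u → u ≤ (1 + 2 * c) * D →
        (ENNReal.ofReal D)⁻¹ ≤ ENNReal.ofReal (1 + 2 * c) * (ENNReal.ofReal u)⁻¹ := by
      intro u hu huD
      have hD : 0 < D := pos_of_mul_pos_right (hu.trans_le huD) hC.le
      rw [← ENNReal.ofReal_inv_of_pos hD, ← ENNReal.ofReal_inv_of_pos hu,
        ← ENNReal.ofReal_mul hC.le]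
      refine ENNReal.ofReal_le_ofReal ?_
      rw [← div_eq_mul_inv, inv_eq_one_div, div_le_div_iff₀ hD hu]
      linarith
    rcases le_total r (L - r) with hrL | hrL
    · rw [min_eq_left hrL] at h1
      refine (hinv (m + r) (by linarith [hr.1]) (by linarith)).trans ?_
      gcongr
      exact le_self_add
    · rw [min_eq_right hrL] at h1
      refine (hinv (m + (L - r)) (by linarith [hr.2]) (by linarith)).trans ?_
      gcongr
      exact le_add_self
  calc qhDist x y ≤ arcLengthIntegral (fun z => (ENNReal.ofReal (bdryDist z))⁻¹) γ s t :=
        iInf_le_of_le γ <| iInf_le_of_le s <| iInf_le_of_le t <|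
          iInf_le_of_le h.toIsRectifiableCurve le_rfl
    _ ≤ ∫⁻ r in Icc 0 L, ENNReal.ofReal (1 + 2 * c) * ((ENNReal.ofReal (m + r))⁻¹ +
        (ENNReal.ofReal (m + (L - r)))⁻¹) := setLIntegral_mono' measurableSet_Icc hpt
    _ = ENNReal.ofReal (2 * (1 + 2 * c) * Real.log (1 + L / m)) := by
        have hlog : 0 ≤ Real.log (1 + L / m) := Real.log_nonneg (by
          have : 0 ≤ L / m := by positivity
          linarith)
        rw [lintegral_const_mul _ (by fun_prop), lintegral_add_left (by fun_prop),
          lintegral_inv_add hm hL, lintegral_inv_add_sub hm hL, ← ENNReal.ofReal_add hlog hlog,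
          ← ENNReal.ofReal_mul hC.le]
        congr 1
        ring
    _ ≤ _ := by gcongr

end Bounds

/-! ### The distance to the boundary attains its maximum -/

section Maximum

variable {X : Type*} [MetricSpace X]

/-- The points that can be reached from `p` by travelling at most time `r` along a `1`-Lipschitz
curve on which the distance to the boundary is at least `δ`. -/
def reachableSet (δ : ℝ) (p : X) (r : ℝ) : Set X :=
  {y | ∃ σ : ℝ → X, LipschitzWith 1 σ ∧ σ 0 = p ∧ (∀ q, δ ≤ bdryDist (σ q)) ∧
    ∃ q ∈ Icc 0 r, σ q = y}

theorem reachableSet_mono {δ : ℝ} {p : X} {r r' : ℝ} (h : r ≤ r') :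
    reachableSet δ p r ⊆ reachableSet δ p r' := by
  rintro y ⟨σ, h1, h2, h3, q, hq, hy⟩
  exact ⟨σ, h1, h2, h3, q, ⟨hq.1, hq.2.trans h⟩, hy⟩

theorem exists_dist_le_of_mem_reachableSet {δ : ℝ} {p : X} {r ε : ℝ} (hr : 0 ≤ r) {y : X}
    (hε : 0 ≤ ε) (hy : y ∈ reachableSet δ p (r + ε)) :
    ∃ z ∈ reachableSet δ p r, dist y z ≤ ε := by
  obtain ⟨σ, h1, h2, h3, q, hq, rfl⟩ := hy
  refine ⟨σ (min q r), ⟨σ, h1, h2, h3, min q r, ⟨le_min hq.1 hr, min_le_right _ _⟩, rfl⟩, ?_⟩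
  refine (h1.dist_le_mul _ _).trans ?_
  rw [NNReal.coe_one, one_mul, Real.dist_eq, abs_of_nonneg (sub_nonneg.2 (min_le_left _ _))]
  rcases le_total q r with h | h
  · rw [min_eq_left h, sub_self]; exact hε
  · rw [min_eq_right h]; linarith [hq.2]

/-- Reachable sets are relatively compact. As in the Hopf–Rinow theorem, the set of radii for which
this holds is closed, by completeness, and relatively open, by local compactness. -/
theorem isCompact_closure_reachableSet [LocallyCompactSpace X] {δ : ℝ} (hδ : 0 < δ) (p : X)
    {R : ℝ} (hR : 0 ≤ R) : IsCompact (closure (reachableSet δ p R)) := by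
  have hsub : ∀ r, closure (reachableSet δ p r) ⊆ {z : X | δ ≤ bdryDist z} := fun r =>
    closure_minimal (by rintro _ ⟨σ, -, -, h3, q, -, rfl⟩; exact h3 q)
      (isClosed_le continuous_const continuous_bdryDist)
  have hcomplete : ∀ r, IsComplete (closure (reachableSet δ p r)) := by
    intro r f hf hle
    obtain ⟨z, -, hz⟩ := isComplete_setOf_le_bdryDist hδ f hf
      (hle.trans (principal_mono.2 (hsub r)))
    have := hf.1
    exact ⟨z, isClosed_iff_clusterPt.1 isClosed_closure z ((ClusterPt.of_le_nhds hz).mono hle), hz⟩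
  have hlimit : ∀ r, 0 ≤ r →
      (∀ ε > 0, ∃ r', 0 ≤ r' ∧ r ≤ r' + ε ∧ IsCompact (closure (reachableSet δ p r'))) →
      IsCompact (closure (reachableSet δ p r)) := by
    intro r hr h
    refine isCompact_iff_totallyBounded_isComplete.2 ⟨TotallyBounded.closure ?_, hcomplete r⟩
    refine Metric.totallyBounded_iff.2 fun ε hε => ?_
    obtain ⟨r', hr', hle, hK⟩ := h (ε / 2) (half_pos hε)
    obtain ⟨T, hT, hcov⟩ := Metric.totallyBounded_iff.1 hK.totallyBounded (ε / 2) (half_pos hε)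
    refine ⟨T, hT, fun y hy => ?_⟩
    obtain ⟨z, hz, hyz⟩ := exists_dist_le_of_mem_reachableSet hr' (half_pos hε).le
      (reachableSet_mono hle hy)
    obtain ⟨w, hw, hzw⟩ := mem_iUnion₂.1 (hcov (subset_closure hz))
    refine mem_iUnion₂.2 ⟨w, hw, ?_⟩
    rw [Metric.mem_ball] at hzw ⊢
    linarith [dist_triangle y z w]
  have hclosed : IsClosed ({r | IsCompact (closure (reachableSet δ p r))} ∩ Icc 0 R) := by
    refine isClosed_of_closure_subset fun r hr => ?_
    have hrR : r ∈ Icc 0 R := closure_minimal inter_subset_right isClosed_Icc hr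
    refine ⟨hlimit r hrR.1 fun ε hε => ?_, hrR⟩
    obtain ⟨r', ⟨hK, hr'⟩, hd⟩ := Metric.mem_closure_iff.1 hr ε hε
    exact ⟨r', hr'.1, by linarith [(abs_lt.1 (Real.dist_eq r r' ▸ hd)).2], hK⟩
  refine hclosed.Icc_subset_of_forall_exists_gt ?_ ?_ (right_mem_Icc.2 hR)
  · have : reachableSet δ p 0 ⊆ {p} := by
      rintro y ⟨σ, -, h2, -, q, hq, rfl⟩
      rw [Icc_self] at hq
      rw [mem_singleton_iff, mem_singleton_iff.1 hq, h2]
    exact isCompact_singleton.of_isClosed_subset isClosed_closure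
      (closure_minimal this isClosed_singleton)
  · rintro r ⟨hK, hr⟩ y hy
    obtain ⟨ε, hε, hKε⟩ := hK.exists_isCompact_cthickening
    refine ⟨min (r + ε) y, ?_, lt_min (by linarith) hy, min_le_right _ _⟩
    refine hKε.of_isClosed_subset isClosed_closure
      (closure_minimal (fun z hz => ?_) Metric.isClosed_cthickening)
    obtain ⟨w, hw, hzw⟩ := exists_dist_le_of_mem_reachableSet hr.1 hε.le
      (reachableSet_mono (min_le_left _ _) hz)
    exact Metric.mem_cthickening_of_dist_le z w ε _ (subset_closure hw) hzw

/-- In a uniform space, any point at least as far from the boundary as `p` is reached from `p`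
along a curve that stays away from the boundary. -/
theorem IsUniform.mem_reachableSet {c : ℝ} (hc : 1 ≤ c) (hX : IsUniform c X) {p z : X}
    (hz : bdryDist p ≤ bdryDist z) {R : ℝ} (hR : c * dist p z ≤ R) :
    z ∈ reachableSet (bdryDist p / (2 * c)) p R := by
  obtain ⟨γ, s, t, h⟩ := hX p z
  set L := (curveLength γ s t).toReal with hLdef
  have hL : 0 ≤ L := ENNReal.toReal_nonneg
  have hLc : L ≤ c * dist p z := ENNReal.toReal_le_of_le_ofReal (by positivity) h.quasiconvex
  refine ⟨fun q => naturalParameterization γ (Icc s t) s (projIcc 0 L hL q), ?_, ?_, ?_, L,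
    ⟨hL, hLc.trans hR⟩, ?_⟩
  · refine LipschitzWith.of_edist_le fun q q' => ?_
    have h1 := h.lipschitzOnWith_naturalParameterization (projIcc 0 L hL q).2 (projIcc 0 L hL q').2
    have h2 := LipschitzWith.projIcc hL q q'
    rw [ENNReal.coe_one, one_mul] at h1 h2
    exact h1.trans h2
  · simp only [projIcc_left]
    exact h.naturalParameterization_zero
  · intro q
    obtain ⟨h1, h2, h3⟩ := h.bdryDist_ge (by linarith) (projIcc 0 L hL q).2
    have hp := bdryDist_nonneg p
    rw [div_le_iff₀ (by linarith)]
    beta_reduce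
    generalize ((projIcc 0 L hL q : Icc 0 L) : ℝ) = r at *
    set D := bdryDist (naturalParameterization γ (Icc s t) s r)
    rw [← hLdef] at h3
    have hD : D ≤ c * D := le_mul_of_one_le_left (bdryDist_nonneg _) hc
    rcases le_total r (L - r) with hrL | hrL
    · rw [min_eq_left hrL] at h1
      linarith
    · rw [min_eq_right hrL] at h1
      linarith
  · simp only [projIcc_right]
    exact h.naturalParameterization_length

theorem IsUniform.exists_forall_bdryDist_le [LocallyCompactSpace X] {c : ℝ} (hc : 1 ≤ c)
    (hX : IsUniform c X) (hinc : ¬ CompleteSpace X) (hb : Bornology.IsBounded (univ : Set X)) :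
    ∃ x₀ : X, ∀ z : X, bdryDist z ≤ bdryDist x₀ := by
  obtain ⟨p⟩ : Nonempty X := by
    by_contra hne
    rw [not_nonempty_iff] at hne
    exact hinc inferInstance
  have hp := bdryDist_pos hinc p
  have hK : IsCompact {z : X | bdryDist p ≤ bdryDist z} := by
    refine (isCompact_closure_reachableSet (δ := bdryDist p / (2 * c)) (by positivity) p
      (R := c * Metric.diam (univ : Set X)) (by positivity)).of_isClosed_subset
      (isClosed_le continuous_const continuous_bdryDist) fun z hz => subset_closure ?_
    refine hX.mem_reachableSet hc hz ?_
    gcongr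
    exact Metric.dist_le_diam_of_mem hb (mem_univ p) (mem_univ z)
  obtain ⟨x₀, hx₀, hmax⟩ := hK.exists_isMaxOn ⟨p, le_refl (bdryDist p)⟩
    continuous_bdryDist.continuousOn
  refine ⟨x₀, fun z => ?_⟩
  rcases le_total (bdryDist p) (bdryDist z) with h | h
  · exact hmax h
  · exact h.trans hx₀

end Maximum

/-! ### Quasihyperbolic geodesics that end at a maximum point -/

section Geodesics

variable {X : Type*} [MetricSpace X] {α : ℝ → X} {l : ℝ} {x y : X}

theorem IsQHGeodesic.dist_le (h : IsQHGeodesic α l x y) (hd : ∀ z : X, 0 < bdryDist z)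
    {s t : ℝ} (hs : s ∈ Icc 0 l) (ht : t ∈ Icc 0 l) :
    dist (α s) (α t) ≤ bdryDist (α s) * (Real.exp |s - t| - 1) := by
  have h1 := log_le_qhDist (y := α t) (hd (α s))
  have hpos : 0 ≤ dist (α s) (α t) / bdryDist (α s) := div_nonneg dist_nonneg (hd _).le
  rw [h.isometry s hs t ht, ENNReal.ofReal_le_ofReal_iff (abs_nonneg _),
    Real.log_le_iff_le_exp (by linarith)] at h1
  rw [← div_le_iff₀' (hd _)]
  linarith

theorem IsQHGeodesic.bdryDist_le (h : IsQHGeodesic α l x y) (hd : ∀ z : X, 0 < bdryDist z)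
    {s t : ℝ} (hs : s ∈ Icc 0 l) (ht : t ∈ Icc 0 l) :
    bdryDist (α s) ≤ bdryDist (α t) * Real.exp |s - t| := by
  have h1 := h.dist_le hd ht hs
  rw [dist_comm, abs_sub_comm] at h1
  linarith [bdryDist_le_add_dist (α s) (α t)]

theorem IsQHGeodesic.injOn (h : IsQHGeodesic α l x y) : InjOn α (Icc 0 l) := by
  intro s hs t ht hst
  have h1 := h.isometry s hs t ht
  rw [hst, h.isometry t ht t ht, sub_self, abs_zero, ENNReal.ofReal_zero, eq_comm,
    ENNReal.ofReal_eq_zero] at h1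
  exact sub_eq_zero.1 (abs_eq_zero.1 (le_antisymm h1 (abs_nonneg _)))

/-- Where `d ≤ M`, a quasihyperbolic geodesic is `2M`-Lipschitz: the estimate `exp h - 1 ≤ 2 * h`
for `h ≤ 1` is applied to the pieces of a fine subdivision. -/
theorem IsQHGeodesic.dist_le_mul (h : IsQHGeodesic α l x y) (hd : ∀ z : X, 0 < bdryDist z)
    {u v M : ℝ} (hu : 0 ≤ u) (huv : u ≤ v) (hv : v ≤ l)
    (hM : ∀ s ∈ Icc u v, bdryDist (α s) ≤ M) :
    dist (α u) (α v) ≤ 2 * M * (v - u) := by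
  obtain ⟨n, hn⟩ := exists_nat_gt (v - u)
  have hn0 : (0 : ℝ) < n := (sub_nonneg.2 huv).trans_lt hn
  set η := (v - u) / n with hη
  have hη0 : 0 ≤ η := div_nonneg (sub_nonneg.2 huv) hn0.le
  have hη1 : η ≤ 1 := (div_le_one hn0).2 hn.le
  have hnη : n * η = v - u := by rw [hη]; field_simp
  have hM0 : 0 ≤ M := (hd _).le.trans (hM u ⟨le_rfl, huv⟩)
  have hmem : ∀ k : ℕ, k ≤ n → u + k * η ∈ Icc u v := by
    intro k hk
    have h1 : (k : ℝ) * η ≤ n * η := by gcongr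
    exact ⟨le_add_of_nonneg_right (by positivity), by linarith⟩
  have h0l : Icc u v ⊆ Icc 0 l := Icc_subset_Icc hu hv
  have hstep : ∀ {k : ℕ}, k < n →
      dist (α (u + k * η)) (α (u + (k + 1 : ℕ) * η)) ≤ 2 * M * η := by
    intro k hk
    have h1 := h.dist_le hd (h0l (hmem k hk.le)) (h0l (hmem (k + 1) hk))
    have h2 : |u + k * η - (u + (k + 1 : ℕ) * η)| = η := by
      rw [abs_sub_comm, show u + ((k + 1 : ℕ) : ℝ) * η - (u + k * η) = η by push_cast; ring,
        abs_of_nonneg hη0]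
    rw [h2] at h1
    have h3 := (abs_le.1 (Real.abs_exp_sub_one_sub_id_le (abs_le.2 ⟨by linarith, hη1⟩))).2
    have h4 : Real.exp η - 1 ≤ 2 * η := by nlinarith
    calc _ ≤ _ := h1
      _ ≤ M * (2 * η) := mul_le_mul (hM _ (hmem k hk.le)) h4
          (sub_nonneg.2 (Real.one_le_exp hη0)) hM0
      _ = 2 * M * η := by ring
  have hsum := dist_le_range_sum_of_dist_le (f := fun k : ℕ => α (u + k * η)) n
    (d := fun _ => 2 * M * η) hstep
  rw [Finset.sum_const, Finset.card_range, nsmul_eq_mul, hnη] at hsum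
  calc dist (α u) (α v) = _ := by simp
    _ ≤ _ := hsum
    _ = 2 * M * (n * η) := by ring
    _ = _ := by rw [hnη]

theorem IsQHGeodesic.lipschitzOnWith (h : IsQHGeodesic α l x y) (hd : ∀ z : X, 0 < bdryDist z)
    {u v M : ℝ} (hu : 0 ≤ u) (hv : v ≤ l) (hM : ∀ s ∈ Icc u v, bdryDist (α s) ≤ M) :
    LipschitzOnWith (2 * M).toNNReal α (Icc u v) := by
  have key : ∀ s ∈ Icc u v, ∀ t ∈ Icc u v, s ≤ t →
      dist (α s) (α t) ≤ (2 * M).toNNReal * dist s t := by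
    intro s hs t ht hst
    have hM0 : 0 ≤ M := (hd _).le.trans (hM s hs)
    rw [Real.coe_toNNReal _ (by positivity), dist_comm s, Real.dist_eq,
      abs_of_nonneg (sub_nonneg.2 hst)]
    exact h.dist_le_mul hd (hu.trans hs.1) hst (ht.2.trans hv) fun q hq =>
      hM q ⟨hs.1.trans hq.1, hq.2.trans ht.2⟩
  refine LipschitzOnWith.of_dist_le_mul fun s hs t ht => ?_
  rcases le_total s t with hst | hst
  · exact key s hs t ht hst
  · rw [dist_comm, dist_comm s]
    exact key t ht s hs hst

theorem IsQHGeodesic.curveLength_le (h : IsQHGeodesic α l x y) (hd : ∀ z : X, 0 < bdryDist z)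
    {u v M : ℝ} (hu : 0 ≤ u) (huv : u ≤ v) (hv : v ≤ l)
    (hM : ∀ s ∈ Icc u v, bdryDist (α s) ≤ M) :
    curveLength α u v ≤ ENNReal.ofReal (2 * M * (v - u)) := by
  have hM0 : 0 ≤ M := (hd _).le.trans (hM u ⟨le_rfl, huv⟩)
  have h1 := (h.lipschitzOnWith hd hu hv hM).comp_eVariationOn_le (g := id) (mapsTo_id _)
  rw [eVariationOn_id_Icc, Function.comp_id] at h1
  rw [ENNReal.ofReal_mul (by positivity)]
  exact h1

theorem IsQHGeodesic.continuousOn (h : IsQHGeodesic α l x y) (hd : ∀ z : X, 0 < bdryDist z)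
    {M : ℝ} (hM : ∀ z : X, bdryDist z ≤ M) : ContinuousOn α (Icc 0 l) :=
  (h.lipschitzOnWith hd le_rfl le_rfl fun _ _ => hM _).continuousOn

/-- Solves the self-improving estimate for the quasihyperbolic length of a subarc, by means of
`log z ≤ 2 * √z`. -/
theorem le_of_le_mul_log {c T : ℝ} (hc : 1 ≤ c)
    (hT : T ≤ 2 * (1 + 2 * c) * Real.log (1 + 4 * c * T)) : T ≤ 720 * c ^ 3 := by
  have hc3 : 1 ≤ c ^ 3 := one_le_pow₀ hc
  by_contra! hlt
  have hT1 : 1 ≤ T := by linarith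
  set w := Real.sqrt (1 + 4 * c * T) with hw
  have hnn : 0 ≤ 1 + 4 * c * T := by positivity
  have hw2 : w ^ 2 = 1 + 4 * c * T := Real.sq_sqrt hnn
  have hlog : Real.log (1 + 4 * c * T) ≤ 2 * w := by
    have h1 := Real.log_le_self (Real.sqrt_nonneg (1 + 4 * c * T))
    rw [Real.log_sqrt hnn] at h1
    linarith
  have h2 : T ≤ 12 * c * w := by
    have hw0 : 0 ≤ w := Real.sqrt_nonneg _
    calc T ≤ 2 * (1 + 2 * c) * (2 * w) := hT.trans (by gcongr)
      _ ≤ 2 * (c + 2 * c) * (2 * w) := by gcongr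
      _ = _ := by ring
  have h3 : T ^ 2 ≤ 720 * c ^ 3 * T := by
    calc T ^ 2 ≤ (12 * c * w) ^ 2 := by gcongr
      _ = 144 * c ^ 2 * (1 + 4 * c * T) := by rw [mul_pow, hw2]; ring
      _ ≤ 144 * c ^ 2 * (c * T + 4 * c * T) := by
        gcongr
        exact one_le_mul_of_one_le_of_one_le hc hT1
      _ = _ := by ring
  nlinarith

/-- A subarc on which `d` varies by a factor at most `2` above its values at the endpoints has
bounded quasihyperbolic length: that length is at most logarithmic in the relative distance of
the endpoints, which in turn is at most linear in it. -/
theorem IsQHGeodesic.sub_le_of_le_two_mul {c : ℝ} (hc : 1 ≤ c) (hX : IsUniform c X)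
    (h : IsQHGeodesic α l x y) (hd : ∀ z : X, 0 < bdryDist z) {u v m : ℝ} (hu : 0 ≤ u)
    (huv : u ≤ v) (hv : v ≤ l) (hm : 0 < m) (hmu : m ≤ bdryDist (α u)) (hmv : m ≤ bdryDist (α v))
    (hM : ∀ s ∈ Icc u v, bdryDist (α s) ≤ 2 * m) : v - u ≤ 720 * c ^ 3 := by
  refine le_of_le_mul_log hc ?_
  have h1 := hX.qhDist_le hc hm hmu hmv
  have h2 := h.dist_le_mul hd hu huv hv hM
  have hpos : 0 ≤ c * dist (α u) (α v) / m := by positivity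
  rw [h.isometry u ⟨hu, huv.trans hv⟩ v ⟨hu.trans huv, hv⟩, abs_sub_comm,
    abs_of_nonneg (sub_nonneg.2 huv), ENNReal.ofReal_le_ofReal_iff (mul_nonneg (by positivity)
      (Real.log_nonneg (by linarith)))] at h1
  refine h1.trans ?_
  gcongr
  rw [div_le_iff₀ hm]
  calc c * dist (α u) (α v) ≤ c * (2 * (2 * m) * (v - u)) := by gcongr
    _ = 4 * c * (v - u) * m := by ring

/-- On a geodesic that ends at a maximum point of `d`, an arc on which `d` stays at most twice its
initial value has bounded quasihyperbolic length: it can be prolonged, with the same bound on `d`,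
until `d` has exactly doubled or the maximum point is reached. -/
theorem IsQHGeodesic.sub_le_of_forall_le_two_mul {c : ℝ} (hc : 1 ≤ c) (hX : IsUniform c X)
    (h : IsQHGeodesic α l x y) (hd : ∀ z : X, 0 < bdryDist z)
    (hmax : ∀ z : X, bdryDist z ≤ bdryDist y) {u t : ℝ} (hu : 0 ≤ u) (hut : u ≤ t) (ht : t ≤ l)
    (hM : ∀ s ∈ Icc u t, bdryDist (α s) ≤ 2 * bdryDist (α u)) : t - u ≤ 720 * c ^ 3 := by
  have hcont : ContinuousOn (fun s => bdryDist (α s)) (Icc 0 l) :=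
    continuous_bdryDist.comp_continuousOn (h.continuousOn hd hmax)
  have hm := hd (α u)
  obtain ⟨v, htv, hvl, hv, hvM⟩ : ∃ v, t ≤ v ∧ v ≤ l ∧ bdryDist (α u) ≤ bdryDist (α v) ∧
      ∀ s ∈ Icc t v, bdryDist (α s) ≤ 2 * bdryDist (α u) := by
    by_cases hex : ∃ w ∈ Icc t l, 2 * bdryDist (α u) ≤ bdryDist (α w)
    · have hcont' := hcont.mono (Icc_subset_Icc (hu.trans hut) le_rfl)
      have hK : IsCompact (Icc t l ∩ (fun s => bdryDist (α s)) ⁻¹' Ici (2 * bdryDist (α u))) :=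
        isCompact_Icc.of_isClosed_subset
          (hcont'.preimage_isClosed_of_isClosed isClosed_Icc isClosed_Ici) inter_subset_left
      obtain ⟨v, ⟨hv, hv2⟩, hleast⟩ := hK.exists_isLeast hex
      rw [mem_preimage, mem_Ici] at hv2
      refine ⟨v, hv.1, hv.2, by linarith, fun s hs => ?_⟩
      by_contra! hlt
      -- An intermediate point where `d` equals twice its initial value would come before `v`.
      obtain ⟨w, hw, hw2⟩ := intermediate_value_Icc hs.1
        (hcont'.mono (Icc_subset_Icc le_rfl (hs.2.trans hv.2))) ⟨hM t ⟨hut, le_rfl⟩, hlt.le⟩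
      have hvw := hleast ⟨⟨hw.1, hw.2.trans (hs.2.trans hv.2)⟩, hw2.ge⟩
      have : w = s := le_antisymm hw.2 (hs.2.trans hvw)
      rw [this] at hw2
      exact hlt.ne' hw2
    · push Not at hex
      exact ⟨l, ht, le_rfl, by rw [h.target]; exact hmax _, fun s hs => (hex s hs).le⟩
  have := h.sub_le_of_le_two_mul hc hX hd hu (hut.trans htv) hvl hm le_rfl hv fun s hs => by
    rcases le_total s t with hst | hst
    · exact hM s ⟨hs.1, hst⟩
    · exact hvM s ⟨hst, hs.2⟩
  linarith

/-- Along a geodesic that ends at a maximum point of `d`, the function `d` never drops by more than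
a bounded factor. -/
theorem IsQHGeodesic.bdryDist_le_of_le {c : ℝ} (hc : 1 ≤ c) (hX : IsUniform c X)
    (h : IsQHGeodesic α l x y) (hd : ∀ z : X, 0 < bdryDist z)
    (hmax : ∀ z : X, bdryDist z ≤ bdryDist y) {s t : ℝ} (hs : 0 ≤ s) (hst : s ≤ t) (ht : t ≤ l) :
    bdryDist (α s) ≤ Real.exp (720 * c ^ 3) * bdryDist (α t) := by
  have hcont : ContinuousOn (fun s => bdryDist (α s)) (Icc 0 t) :=
    continuous_bdryDist.comp_continuousOn
      ((h.continuousOn hd hmax).mono (Icc_subset_Icc le_rfl ht))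
  obtain ⟨u, hu, humax⟩ := isCompact_Icc.exists_isMaxOn ⟨s, hs, hst⟩ hcont
  have h1 := h.sub_le_of_forall_le_two_mul hc hX hd hmax hu.1 hu.2 ht fun q hq => by
    have h2 : bdryDist (α q) ≤ bdryDist (α u) := humax ⟨hu.1.trans hq.1, hq.2⟩
    linarith [hd (α u)]
  have h0t : 0 ≤ t := hs.trans hst
  calc bdryDist (α s) ≤ bdryDist (α u) := humax ⟨hs, hst⟩
    _ ≤ bdryDist (α t) * Real.exp |u - t| :=
        h.bdryDist_le hd ⟨hu.1, hu.2.trans ht⟩ ⟨h0t, ht⟩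
    _ ≤ bdryDist (α t) * Real.exp (720 * c ^ 3) := by
        have := (hd (α t)).le
        gcongr
        rw [abs_sub_comm, abs_of_nonneg (sub_nonneg.2 hu.2)]
        exact h1
    _ = _ := mul_comm _ _

/-- The length of an initial arc is controlled by the maximum of `d` on it. Going back by a fixed
quasihyperbolic distance halves that maximum, so the lengths add up like a geometric series. -/
theorem IsQHGeodesic.curveLength_zero_le {c : ℝ} (hc : 1 ≤ c) (hX : IsUniform c X)
    (h : IsQHGeodesic α l x y) (hd : ∀ z : X, 0 < bdryDist z)
    (hmax : ∀ z : X, bdryDist z ≤ bdryDist y) {t M : ℝ} (ht : t ∈ Icc 0 l)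
    (hM : ∀ s ∈ Icc 0 t, bdryDist (α s) ≤ M) :
    curveLength α 0 t ≤ ENNReal.ofReal (4 * (720 * c ^ 3 + 1) * M) := by
  set τ := 720 * c ^ 3 + 1 with hτ
  have hτ0 : 0 < τ := by positivity
  obtain ⟨n, hn⟩ := exists_nat_ge (t / τ)
  rw [div_le_iff₀ hτ0] at hn
  induction n generalizing t M with
  | zero =>
    have ht0 : t = 0 := le_antisymm (by simpa using hn) ht.1
    subst ht0
    rw [curveLength, eVariationOn.subsingleton α (by simp)]
    exact zero_le
  | succ n ih =>
    have hM0 : 0 ≤ M := (hd _).le.trans (hM 0 ⟨le_rfl, ht.1⟩)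
    rcases le_total t τ with htτ | htτ
    · refine (h.curveLength_le hd le_rfl ht.1 ht.2 hM).trans (ENNReal.ofReal_le_ofReal ?_)
      nlinarith [mul_nonneg hM0 hτ0.le, mul_le_mul_of_nonneg_left htτ hM0]
    · have hhalf : ∀ s ∈ Icc 0 (t - τ), bdryDist (α s) ≤ M / 2 := by
        intro u hu
        by_contra! hlt
        have := h.sub_le_of_forall_le_two_mul hc hX hd hmax hu.1 (by linarith [hu.2]) ht.2
          fun s hs => (hM s ⟨hu.1.trans hs.1, hs.2⟩).trans (by linarith)
        linarith [hu.2]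
      have h1 := ih (t := t - τ) (M := M / 2) ⟨by linarith, by linarith [ht.2]⟩ hhalf
        (by push_cast at hn; linarith)
      have h2 := h.curveLength_le hd (u := t - τ) (v := t) (M := M) (by linarith) (by linarith)
        ht.2 fun s hs => hM s ⟨by linarith [hs.1], hs.2⟩
      rw [← curveLength_add α (q := t - τ) (by linarith) (by linarith)]
      refine (add_le_add h1 h2).trans ?_
      rw [← ENNReal.ofReal_add (by positivity) (mul_nonneg (by positivity) (by linarith))]
      refine ENNReal.ofReal_le_ofReal (le_of_eq ?_)
      ring

theorem IsUniform.isQHJohnWithCenter {c : ℝ} (hc : 1 ≤ c) (hX : IsUniform c X)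
    (hd : ∀ z : X, 0 < bdryDist z) {x₀ : X} (hmax : ∀ z : X, bdryDist z ≤ bdryDist x₀) :
    IsQHJohnWithCenter (4 * (720 * c ^ 3 + 1) * Real.exp (720 * c ^ 3)) x₀ := by
  intro x α l h
  refine ⟨h.nonneg, h.continuousOn hd hmax, h.injOn, h.source, h.target, fun t ht => ?_⟩
  rw [mul_assoc]
  exact h.curveLength_zero_le hc hX hd hmax ht fun s hs =>
    h.bdryDist_le_of_le hc hX hd hmax hs.1 hs.2 ht.2

end Geodesics

end QH

theorem proposition1p2 :
    ∀ c : ℝ, 1 ≤ c → ∃ a : ℝ, 1 ≤ a ∧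
      ∀ (X : Type*) [MetricSpace X] [LocallyCompactSpace X],
        ¬ CompleteSpace X → QH.RectifiablyConnected X →
        Bornology.IsBounded (Set.univ : Set X) → QH.IsUniform c X →
          (∃ x₀ : X, ∀ z : X, QH.bdryDist z ≤ QH.bdryDist x₀) ∧
          ∀ x₀ : X, (∀ z : X, QH.bdryDist z ≤ QH.bdryDist x₀) →
            QH.IsQHJohnWithCenter a x₀ := by
  intro c hc
  refine ⟨4 * (720 * c ^ 3 + 1) * Real.exp (720 * c ^ 3), ?_, ?_⟩
  · have h1 : 0 ≤ 720 * c ^ 3 := by positivity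
    have h2 := Real.one_le_exp h1
    nlinarith
  · intro X _ _ hinc _ hb hX
    exact ⟨hX.exists_forall_bdryDist_le hc hinc hb, fun x₀ hmax =>
      hX.isQHJohnWithCenter hc (QH.bdryDist_pos hinc) hmax⟩
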